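/- Let $\mathbb C_+=\{z\in\mathbb C:\operatorname{Im} z>0\}$ and let $m_2$ be two-dimensional Lebesgue measure. For $\nu>-1$ and $q>0$ let $A^q_\nu(\mathbb C_+)$ be the space of all holomorphic functions $g$ on $\mathbb C_+$ with $$\|g\|_{q,\nu}=\Big(\int_{\mathbb C_+}|g(z)|^q(\operatorname{Im} z)^\nu\,dm_2(z)\Big)^{1/q}<\infty,$$ and for $t>0$ let $A^\infty_t(\mathbb C_+)$ be the space of all holomorphic functions $g$ on $\mathbb C_+$ with $$\|g\|_{A^\infty_t}=\sup_{z\in\mathbb C_+}|g(z)|(\operatorname{Im} z)^t<\infty.$$ For $f\in A^\infty_t(\mathbb C_+)$ and $\epsilon>0$ put $V_{\epsilon,t}(f)=\{z\in\mathbb C_+: |f(z)|(\operatorname{Im} z)^t\ge\epsilon\}$. **Theorem.** Let $q>1$, $\nu>-1$, $t=\frac{\nu+2}{q}$, $\beta>\max\big(\frac{\nu}{q},\frac{\nu+2}{q}-1\big)$ and $f\in A^\infty_t(\mathbb C_+)$. Then $$\inf_{g\in A^q_\nu(\mathbb C_+)}\|f-g\|_{A^\infty_t}=\inf\left\{\epsilon>0:\int_{\mathbb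 C_+}\left(\int_{V_{\epsilon,t}(f)}\frac{(\operatorname{Im} w)^{\beta-t}}{|\overline w-z|^{\beta+2}}\,dm_2(w)\right)^{q}(\operatorname{Im} z)^\nu\,dm_2(z)<\infty\right\}.$$ -/

import Mathlib

open MeasureTheory UpperHalfPlane
open scoped ENNReal ComplexConjugate

/-- The norm `‖f‖_{q,ν} = (∫_{ℂ₊} |f(z)|^q (Im z)^ν dm₂(z))^{1/q}`, with values in `[0, ∞]`. -/
noncomputable def bergmanNorm (q ν : ℝ) (f : ℂ → ℂ) : ℝ≥0∞ :=
  (∫⁻ z in upperHalfPlaneSet, ENNReal.ofReal (‖f z‖ ^ q * z.im ^ ν)) ^ (1 / q)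

/-- The weighted Bergman space `A^q_ν(ℂ₊)`. Elements are represented by functions on `ℂ`;
only the values on `ℂ₊` matter. -/
def bergmanSpace (q ν : ℝ) : Set (ℂ → ℂ) :=
  {f | DifferentiableOn ℂ f upperHalfPlaneSet ∧ bergmanNorm q ν f < ∞}

/-- The norm `‖f‖_{A^∞_t} = sup_{z ∈ ℂ₊} |f(z)| (Im z)^t`, with values in `[0, ∞]`. -/
noncomputable def growthNorm (t : ℝ) (f : ℂ → ℂ) : ℝ≥0∞ :=
  ⨆ z ∈ upperHalfPlaneSet, ENNReal.ofReal (‖f z‖ * z.im ^ t)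

/-- The space `A^∞_t(ℂ₊)`, represented in the same way. -/
def growthSpace (t : ℝ) : Set (ℂ → ℂ) :=
  {f | DifferentiableOn ℂ f upperHalfPlaneSet ∧ growthNorm t f < ∞}

/-- The distance `inf_{g ∈ X} ‖f - g‖_{A^∞_t}`. -/
noncomputable def growthDist (t : ℝ) (f : ℂ → ℂ) (X : Set (ℂ → ℂ)) : ℝ≥0∞ :=
  ⨅ g ∈ X, growthNorm t (f - g)

/-- The set `V_{ε,t}(f) = {z ∈ ℂ₊ : |f(z)| (Im z)^t ≥ ε}`. -/
def superlevelSet (ε t : ℝ) (f : ℂ → ℂ) : Set ℂ :=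
  {z | z ∈ upperHalfPlaneSet ∧ ε ≤ ‖f z‖ * z.im ^ t}

/-- The integral over `z ∈ ℂ₊` of
`(∫_{V_{ε,t}(f)} (Im w)^{β-t} / |w̄ - z|^{β+2} dm₂(w))^q (Im z)^ν`, with values in `[0, ∞]`. -/
noncomputable def superlevelIntegral (q ν t β ε : ℝ) (f : ℂ → ℂ) : ℝ≥0∞ :=
  ∫⁻ z in upperHalfPlaneSet,
    (∫⁻ w in superlevelSet ε t f,
      ENNReal.ofReal (w.im ^ (β - t) / ‖conj w - z‖ ^ (β + 2))) ^ q * ENNReal.ofReal (z.im ^ ν)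

/-! Both sides equal the boundary size of `f`: the infimum of the `l` such that `|f| (Im z)^t ≤ l`
off some compact subset of the half-plane. Three facts give this.

Since `t q = ν + 2`, Whitney balls scale correctly. If the integral converges at height `ε`, then
for `ε' > ε` every point of the `ε'`-superlevel set has a Whitney ball inside the `ε`-superlevel
set. That ball contributes at least a fixed amount to the outer integral, so such points stay in a
compact set (`exists_isCompact_superlevelSet_subset`).

Conversely, a Bergman function `g` satisfies `|g| (Im z)^t → 0` off compact sets
(`exists_isCompact_forall_norm_mul_rpow_le`). Hence above the height `‖f - g‖` the superlevel sets
of `f` are relatively compact, and there the kernel integral converges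
(`superlevelIntegral_lt_top_of_subset`).

Finally, the distance is at most the boundary size (`growthDist_bergmanSpace_le`). A single
approximant of `f` may have error `2A` in the region where it passes from `f` to `0`. Averaging `N`
approximants whose transition regions are disjoint reduces this excess to `2A / N`
(`exists_mem_decaySubmodule_sum`). No projection or duality is needed. -/

/-! ### Convergence of a model integral on the half-plane -/

theorem integrableOn_Ioi_rpow_mul_one_add_rpow {ν b : ℝ} (hν : -1 < ν) (hb : ν + 1 < b) :
    IntegrableOn (fun y : ℝ => y ^ ν * (1 + y) ^ (-b)) (Set.Ioi 0) := by
  have hb0 : 0 < b := by linarith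
  rw [← Set.Ioc_union_Ioi_eq_Ioi zero_le_one]
  refine IntegrableOn.union ?_ ?_
  · have h := (intervalIntegral.intervalIntegrable_rpow' (a := 0) (b := 1) hν).1
    refine Integrable.mono' h (by fun_prop) ?_
    filter_upwards [ae_restrict_mem measurableSet_Ioc] with y hy
    have h1 : 0 ≤ y ^ ν := Real.rpow_nonneg hy.1.le _
    have h2 : (1 + y) ^ (-b) ≤ 1 := Real.rpow_le_one_of_one_le_of_nonpos
      (by linarith [hy.1]) (by linarith)
    have h3 : 0 ≤ (1 + y) ^ (-b) := Real.rpow_nonneg (by linarith [hy.1]) _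
    rw [Real.norm_of_nonneg (mul_nonneg h1 h3)]
    exact mul_le_of_le_one_right h1 h2
  · have h := integrableOn_Ioi_rpow_of_lt (a := ν - b) (by linarith) zero_lt_one
    refine Integrable.mono' h (by fun_prop) ?_
    filter_upwards [ae_restrict_mem measurableSet_Ioi] with y hy
    have hy : 1 < y := hy
    have hy0 : 0 < y := by linarith
    have h1 : 0 ≤ y ^ ν := Real.rpow_nonneg hy0.le _
    have h3 : 0 ≤ (1 + y) ^ (-b) := Real.rpow_nonneg (by linarith) _
    have h2 : (1 + y) ^ (-b) ≤ y ^ (-b) :=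
      Real.rpow_le_rpow_of_nonpos hy0 (by linarith) (by linarith)
    rw [Real.norm_of_nonneg (mul_nonneg h1 h3), sub_eq_add_neg, Real.rpow_add hy0]
    exact mul_le_mul_of_nonneg_left h2 h1

theorem one_add_im_le_norm_add_I (z : ℂ) : 1 + z.im ≤ ‖z + Complex.I‖ := by
  have h := (le_abs_self _).trans (Complex.abs_im_le_norm (z + Complex.I))
  simpa [add_comm] using h

theorem norm_add_I_rpow_le {z : ℂ} (hz : z ∈ upperHalfPlaneSet) {a b : ℝ} (ha : 0 ≤ a)
    (hb : 0 ≤ b) :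
    ‖z + Complex.I‖ ^ (-(a + b)) ≤ (1 + ‖z.re‖ ^ 2) ^ (-a / 2) * (1 + z.im) ^ (-b) := by
  have hz' : 0 < z.im := hz
  have h1 := one_add_im_le_norm_add_I z
  have h0 : 0 < ‖z + Complex.I‖ := by linarith
  have h2 : 1 + ‖z.re‖ ^ 2 ≤ ‖z + Complex.I‖ ^ 2 := by
    rw [Complex.sq_norm, Complex.normSq_apply]
    simp only [Complex.add_re, Complex.I_re, Complex.add_im, Complex.I_im, Real.norm_eq_abs,
      sq_abs]
    nlinarith
  rw [neg_add, Real.rpow_add h0]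
  refine mul_le_mul ?_ (Real.rpow_le_rpow_of_nonpos (by linarith) h1 (by linarith))
    (by positivity) (by positivity)
  have h3 : ‖z + Complex.I‖ ^ (-a) = (‖z + Complex.I‖ ^ 2) ^ (-a / 2) := by
    rw [← Real.rpow_natCast, ← Real.rpow_mul h0.le]
    congr 1
    push_cast
    ring
  rw [h3]
  exact Real.rpow_le_rpow_of_nonpos (by positivity) h2 (by linarith)

/-- The integrand is dominated by a product of functions of `Re z` and `Im z`. Half of the surplus
`p - ν - 2` goes to each factor, so both one-variable integrals converge. -/
theorem lintegral_norm_add_I_rpow_lt_top {ν p : ℝ} (hν : -1 < ν) (hp : ν + 2 < p) :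
    ∫⁻ z in upperHalfPlaneSet, ENNReal.ofReal (‖z + Complex.I‖ ^ (-p) * z.im ^ ν) < ∞ := by
  obtain ⟨η, hη, rfl⟩ : ∃ η, 0 < η ∧ p = (1 + η) + (ν + 1 + η) :=
    ⟨(p - ν - 2) / 2, by linarith, by ring⟩
  set F : ℝ → ℝ≥0∞ := fun x => ENNReal.ofReal ((1 + ‖x‖ ^ 2) ^ (-(1 + η) / 2))
  set G : ℝ → ℝ≥0∞ := (Set.Ioi 0).indicator
    fun y => ENNReal.ofReal (y ^ ν * (1 + y) ^ (-(ν + 1 + η)))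
  have hF : ∫⁻ x, F x < ∞ :=
    (integrable_rpow_neg_one_add_norm_sq (E := ℝ) (μ := volume) (r := 1 + η)
      (by simpa using hη)).lintegral_lt_top
  have hG : ∫⁻ y, G y < ∞ := by
    rw [lintegral_indicator measurableSet_Ioi]
    exact (integrableOn_Ioi_rpow_mul_one_add_rpow hν (by linarith)).lintegral_lt_top
  have hFm : Measurable F := by fun_prop
  have hGm : Measurable G := Measurable.indicator (by fun_prop) measurableSet_Ioi
  have hprod : ∫⁻ z : ℂ, F z.re * G z.im = (∫⁻ x, F x) * ∫⁻ y, G y := by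
    have hm : Measurable fun p : ℝ × ℝ => F p.1 * G p.2 :=
      (hFm.comp measurable_fst).mul (hGm.comp measurable_snd)
    rw [← lintegral_prod_mul hFm.aemeasurable hGm.aemeasurable, ← Measure.volume_eq_prod,
      ← Complex.volume_preserving_equiv_real_prod.lintegral_comp hm]
    rfl
  refine lt_of_le_of_lt ?_ (hprod ▸ ENNReal.mul_lt_top hF hG)
  refine (setLIntegral_mono' isOpen_upperHalfPlaneSet.measurableSet fun z hz => ?_).trans
    (setLIntegral_le_lintegral _ _)
  have hz' : z.im ∈ Set.Ioi (0 : ℝ) := hz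
  have hz0 : 0 < z.im := hz
  simp only [F, G, Set.indicator_of_mem hz']
  rw [← ENNReal.ofReal_mul (by positivity)]
  refine ENNReal.ofReal_le_ofReal ?_
  calc _ ≤ ((1 + ‖z.re‖ ^ 2) ^ (-(1 + η) / 2) * (1 + z.im) ^ (-(ν + 1 + η))) * z.im ^ ν :=
        mul_le_mul_of_nonneg_right
          (norm_add_I_rpow_le hz (by linarith) (by linarith)) (by positivity)
    _ = _ := by ring

/-! ### Whitney balls far from compact sets -/

theorem isCompact_setOf_le_im_norm_le (a R : ℝ) : IsCompact {z : ℂ | a ≤ z.im ∧ ‖z‖ ≤ R} := by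
  refine Metric.isCompact_of_isClosed_isBounded ?_ ?_
  · exact (isClosed_le continuous_const Complex.continuous_im).inter
      (isClosed_le continuous_norm continuous_const)
  · exact (Metric.isBounded_closedBall (x := (0 : ℂ)) (r := R)).subset fun z hz => by
      simpa using hz.2

theorem abs_im_sub_im_lt {z w : ℂ} {r : ℝ} (hw : w ∈ Metric.ball z r) : |w.im - z.im| < r := by
  rw [Metric.mem_ball, dist_eq_norm] at hw
  simpa using (Complex.abs_im_le_norm (w - z)).trans_lt hw

/-- A function with finite integral over the half-plane has small integrals over Whitney balls
whose centres leave all compact subsets. -/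
theorem exists_isCompact_forall_setLIntegral_ball_lt {h : ℂ → ℝ≥0∞}
    (hh : ∫⁻ z in upperHalfPlaneSet, h z < ∞) {c : ℝ≥0∞} (hc : 0 < c) {δ : ℝ}
    (hδ' : δ ≤ 1 / 2) :
    ∃ K ⊆ upperHalfPlaneSet, IsCompact K ∧ ∀ z ∈ upperHalfPlaneSet, z ∉ K →
      ∫⁻ w in Metric.ball z (δ * z.im), h w < c := by
  -- The finite measure `h dm₂` is continuous from above along the sets `S n`, which decrease to the
  -- empty set.
  set μ : Measure ℂ := (volume.restrict upperHalfPlaneSet).withDensity h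
  set S : ℕ → Set ℂ := fun n =>
    upperHalfPlaneSet \ {z : ℂ | 1 / ((n : ℝ) + 1) ≤ z.im ∧ ‖z‖ ≤ n}
  have hSm : ∀ n, MeasurableSet (S n) := fun n =>
    isOpen_upperHalfPlaneSet.measurableSet.diff
      (isCompact_setOf_le_im_norm_le _ _).isClosed.measurableSet
  have hSanti : Antitone S := by
    intro m n hmn z hz
    refine ⟨hz.1, fun hz' => hz.2 ⟨?_, ?_⟩⟩
    · refine le_trans ?_ hz'.1
      gcongr
    · exact hz'.2.trans (by exact_mod_cast hmn)
  have hSint : ⋂ n, S n = ∅ := by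
    refine Set.eq_empty_iff_forall_notMem.2 fun z hz => ?_
    rw [Set.mem_iInter] at hz
    have hz0 : 0 < z.im := (hz 0).1
    obtain ⟨n, hn⟩ := exists_nat_ge (max (1 / z.im) ‖z‖)
    refine (hz n).2 ⟨?_, (le_max_right _ _).trans hn⟩
    have h1 : 1 / z.im ≤ n := (le_max_left _ _).trans hn
    rw [div_le_iff₀ hz0] at h1
    rw [div_le_iff₀ (by positivity)]
    linarith
  have hμ : μ Set.univ < ∞ := by
    rw [withDensity_apply _ MeasurableSet.univ, Measure.restrict_univ]
    exact hh
  have hlim := tendsto_measure_iInter_atTop (μ := μ) (fun n => (hSm n).nullMeasurableSet) hSanti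
    ⟨0, ((measure_mono (Set.subset_univ _)).trans_lt hμ).ne⟩
  rw [hSint, measure_empty] at hlim
  obtain ⟨n, hn⟩ := (hlim.eventually_lt_const hc).exists
  -- Both bounds are relaxed by a factor 2: since `δ ≤ 1/2`, a Whitney ball centred off the larger
  -- compact set misses the smaller one.
  set a : ℝ := 1 / (2 * ((n : ℝ) + 1))
  have ha : 0 < a := by positivity
  refine ⟨{z : ℂ | a ≤ z.im ∧ ‖z‖ ≤ 2 * n}, fun z hz => ha.trans_le hz.1,
    isCompact_setOf_le_im_norm_le _ _, fun z hz hzK => ?_⟩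
  have hz0 : 0 < z.im := hz
  have hδz : δ * z.im ≤ 1 / 2 * z.im := mul_le_mul_of_nonneg_right hδ' hz0.le
  have hsub : Metric.ball z (δ * z.im) ⊆ S n := by
    intro w hw
    have hw1 := abs_lt.1 (abs_im_sub_im_lt hw)
    refine ⟨show 0 < w.im by linarith, fun hwn => hzK ⟨?_, ?_⟩⟩
    · have h1 := hwn.1
      have h2 : a = 1 / ((n : ℝ) + 1) * (1 / 2) := by
        simp only [a]; field_simp
      linarith
    · have h1 := hwn.2
      rw [Metric.mem_ball, dist_eq_norm, norm_sub_rev] at hw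
      have h2 : ‖z‖ ≤ ‖w‖ + ‖z - w‖ := by simpa using norm_add_le w (z - w)
      have h3 := (le_abs_self _).trans (Complex.abs_im_le_norm z)
      linarith
  refine lt_of_le_of_lt ?_ hn
  rw [Function.comp_apply, withDensity_apply _ (hSm n), Measure.restrict_restrict (hSm n),
    Set.inter_eq_left.2 (fun z (hz : z ∈ S n) => hz.1)]
  exact lintegral_mono_set hsub

/-! ### Area mean value inequalities -/

theorem lintegral_id_Ioo {R : ℝ} (hR : 0 ≤ R) :
    ∫⁻ r in Set.Ioo 0 R, ENNReal.ofReal r = ENNReal.ofReal (R ^ 2 / 2) := by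
  have h : ∫ r in (0 : ℝ)..R, r = R ^ 2 / 2 := by simp
  rw [intervalIntegral.integral_of_le hR, ← integral_Ioc_eq_integral_Ioo.symm] at h
  rw [← h, ofReal_integral_eq_lintegral_ofReal]
  · exact (continuous_id.integrableOn_Icc (a := 0) (b := R)).mono_set Set.Ioo_subset_Icc_self
  · filter_upwards [ae_restrict_mem measurableSet_Ioo] with r hr using hr.1.le

theorem Complex.volume_ball_eq_ofReal (c : ℂ) {r : ℝ} (hr : 0 ≤ r) :
    volume (Metric.ball c r) = ENNReal.ofReal (r ^ 2 * Real.pi) := by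
  rw [Complex.volume_ball, ENNReal.ofReal_mul (by positivity), ENNReal.ofReal_pow hr,
    ← NNReal.coe_real_pi, ENNReal.ofReal_coe_nnreal]

/-- The area form of the mean value inequality for holomorphic functions. -/
theorem enorm_mul_volume_ball_le_lintegral {g : ℂ → ℂ} {c : ℂ} {R : ℝ} (hR : 0 < R)
    (hg : DifferentiableOn ℂ g (Metric.ball c R)) :
    ‖g c‖ₑ * volume (Metric.ball c R) ≤ ∫⁻ z in Metric.ball c R, ‖g z‖ₑ := by
  set h : ℂ → ℝ≥0∞ := (Metric.ball (0 : ℂ) R).indicator fun z => ‖g (c + z)‖ₑ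
  have hcont : ContinuousOn (fun z => g (c + z)) (Metric.ball (0 : ℂ) R) :=
    hg.continuousOn.comp (by fun_prop) fun z hz => by simpa using hz
  have hm : Measurable h := by
    classical
    have := (hcont.enorm).measurable_piecewise (g := fun _ => (0 : ℝ≥0∞))
      continuousOn_const Metric.isOpen_ball.measurableSet
    convert this using 1
    ext z
    simp [h, Set.indicator_apply, Set.piecewise]
  have hI : ∫⁻ z in Metric.ball c R, ‖g z‖ₑ = ∫⁻ z, h z := by
    rw [← lintegral_indicator Metric.isOpen_ball.measurableSet,
      ← lintegral_add_left_eq_self _ c]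
    classical
    congr 1
    ext z
    simp only [h, Set.indicator_apply, Metric.mem_ball, dist_self_add_left, dist_zero_right]
  -- The mean value property on each circle, with angles shifted to `(-π, π)` to match polar
  -- coordinates; integration against `r dr` then gives the area form.
  have hcirc : ∀ r ∈ Set.Ioo 0 R, ‖g c‖ₑ * ENNReal.ofReal (2 * Real.pi) ≤
      ∫⁻ θ in Set.Ioo (-Real.pi) Real.pi, h (Complex.polarCoord.symm (r, θ)) := by
    intro r hr
    have hd : DiffContOnCl ℂ g (Metric.ball c |r|) := by
      rw [abs_of_pos hr.1]
      exact (hg.mono (Metric.closedBall_subset_ball hr.2)).diffContOnCl_ball subset_rfl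
    have h1 := hd.circleAverage
    rw [Real.circleAverage_eq_integral_add (-Real.pi),
      intervalIntegral.integral_comp_add_right (fun θ => g (circleMap c r θ)),
      intervalIntegral.integral_of_le (by linarith [Real.pi_pos]),
      show 0 + -Real.pi = -Real.pi by ring, show 2 * Real.pi + -Real.pi = Real.pi by ring,
      integral_Ioc_eq_integral_Ioo, inv_smul_eq_iff₀ (by positivity)] at h1
    calc ‖g c‖ₑ * ENNReal.ofReal (2 * Real.pi) = ‖(2 * Real.pi) • g c‖ₑ := by
          rw [enorm_smul, Real.enorm_of_nonneg (by positivity), mul_comm]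
      _ ≤ ∫⁻ θ in Set.Ioo (-Real.pi) Real.pi, ‖g (circleMap c r θ)‖ₑ := by
          rw [← h1]
          exact enorm_integral_le_lintegral_enorm _
      _ = _ := by
          refine lintegral_congr fun θ => ?_
          have h2 : Complex.polarCoord.symm (r, θ) ∈ Metric.ball (0 : ℂ) R := by
            rw [mem_ball_zero_iff, Complex.norm_polarCoord_symm, abs_of_pos hr.1]
            exact hr.2
          simp only [h, Set.indicator_of_mem h2]
          rw [Complex.polarCoord_symm_apply, circleMap, Complex.exp_mul_I]
          simp
  have hm2 : Measurable fun p : ℝ × ℝ =>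
      ENNReal.ofReal p.1 • h (Complex.polarCoord.symm p) := by
    refine Measurable.mul (by fun_prop) (hm.comp ?_)
    rw [show (Complex.polarCoord.symm : ℝ × ℝ → ℂ) =
      fun p => p.1 * (Real.cos p.2 + Real.sin p.2 * Complex.I) from
        funext Complex.polarCoord_symm_apply]
    fun_prop
  rw [hI, ← Complex.lintegral_comp_polarCoord_symm, polarCoord_target, Measure.volume_eq_prod,
    ← Measure.prod_restrict, lintegral_prod _ hm2.aemeasurable]
  calc ‖g c‖ₑ * volume (Metric.ball c R)
      = ∫⁻ r in Set.Ioo 0 R, ENNReal.ofReal r * (‖g c‖ₑ * ENNReal.ofReal (2 * Real.pi)) := by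
        rw [lintegral_mul_const _ (by fun_prop), lintegral_id_Ioo hR.le,
          Complex.volume_ball_eq_ofReal _ hR.le, mul_left_comm,
          ← ENNReal.ofReal_mul (by positivity)]
        congr 2
        ring
    _ ≤ ∫⁻ r in Set.Ioo 0 R, ∫⁻ θ in Set.Ioo (-Real.pi) Real.pi,
          ENNReal.ofReal r • h (Complex.polarCoord.symm (r, θ)) := by
        refine setLIntegral_mono' measurableSet_Ioo fun r hr => ?_
        simp only [smul_eq_mul]
        rw [lintegral_const_mul' _ _ ENNReal.ofReal_ne_top]
        gcongr
        exact hcirc r hr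
    _ ≤ _ := lintegral_mono_set fun r hr => hr.1

/-- The `q`-th power form of the area mean value inequality. -/
theorem enorm_rpow_mul_volume_ball_le_lintegral {g : ℂ → ℂ} {c : ℂ} {R q : ℝ} (hR : 0 < R)
    (hq : 1 ≤ q) (hg : DifferentiableOn ℂ g (Metric.ball c R)) :
    ‖g c‖ₑ ^ q * volume (Metric.ball c R) ≤ ∫⁻ z in Metric.ball c R, ‖g z‖ₑ ^ q := by
  have hq0 : 0 < q := by linarith
  have hV0 : volume (Metric.ball c R) ≠ 0 := (Metric.measure_ball_pos _ _ hR).ne'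
  have hVt : volume (Metric.ball c R) ≠ ∞ := measure_ball_lt_top.ne
  have h1 := enorm_mul_volume_ball_le_lintegral hR hg
  -- Hölder on the ball compares the exponents 1 and `q`; the surplus factor `volume ^ (q - 1)` is
  -- cancelled at the end.
  have h2 := eLpNorm'_le_eLpNorm'_mul_rpow_measure_univ (μ := volume.restrict (Metric.ball c R))
    zero_lt_one hq (hg.continuousOn.aestronglyMeasurable Metric.isOpen_ball.measurableSet)
  simp only [eLpNorm', ENNReal.rpow_one, div_one, Measure.restrict_apply_univ] at h2
  have h3 := ENNReal.rpow_le_rpow (h1.trans h2) hq0.le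
  rw [ENNReal.mul_rpow_of_nonneg _ _ hq0.le, ENNReal.mul_rpow_of_nonneg _ _ hq0.le,
    ← ENNReal.rpow_mul, ← ENNReal.rpow_mul, one_div_mul_cancel hq0.ne', ENNReal.rpow_one,
    show (1 - 1 / q) * q = q - 1 by field_simp] at h3
  have h4 : volume (Metric.ball c R) ^ q =
      volume (Metric.ball c R) * volume (Metric.ball c R) ^ (q - 1) := by
    conv_lhs => rw [show q = 1 + (q - 1) by ring, ENNReal.rpow_add _ _ hV0 hVt,
      ENNReal.rpow_one]
  rw [h4, ← mul_assoc] at h3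
  refine (ENNReal.mul_le_mul_iff_left ?_ ?_).1 h3
  · exact (ENNReal.rpow_pos (pos_iff_ne_zero.2 hV0) hVt).ne'
  · exact ENNReal.rpow_ne_top_of_nonneg (by linarith) hVt

/-! ### Boundary decay of Bergman functions -/

theorem two_rpow_neg_abs_mul_rpow_le {y v : ℝ} (hy : 0 < y) (h1 : y / 2 ≤ v) (h2 : v ≤ 2 * y)
    (s : ℝ) : 2 ^ (-|s|) * y ^ s ≤ v ^ s := by
  rcases le_total 0 s with hs | hs
  · refine le_trans (le_of_eq ?_) (Real.rpow_le_rpow (by positivity) h1 hs)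
    rw [abs_of_nonneg hs, Real.div_rpow hy.le zero_le_two, Real.rpow_neg zero_le_two]
    field_simp
  · refine le_trans (le_of_eq ?_) (Real.rpow_le_rpow_of_nonpos (by linarith) h2 hs)
    rw [abs_of_nonpos hs, Real.mul_rpow zero_le_two hy.le, neg_neg]

theorem half_im_le_and_im_le_two_mul {z w : ℂ} (hz : 0 < z.im) {δ : ℝ} (hδ : δ ≤ 1 / 2)
    (hw : w ∈ Metric.ball z (δ * z.im)) : z.im / 2 ≤ w.im ∧ w.im ≤ 2 * z.im := by
  have h1 := abs_lt.1 (abs_im_sub_im_lt hw)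
  have h2 : δ * z.im ≤ 1 / 2 * z.im := mul_le_mul_of_nonneg_right hδ hz.le
  constructor <;> linarith

theorem growthNorm_le_ofReal_iff {t a : ℝ} (ha : 0 ≤ a) {f : ℂ → ℂ} :
    growthNorm t f ≤ ENNReal.ofReal a ↔ ∀ z ∈ upperHalfPlaneSet, ‖f z‖ * z.im ^ t ≤ a := by
  simp only [growthNorm, iSup_le_iff, ENNReal.ofReal_le_ofReal_iff ha]

theorem bergmanNorm_lt_top_iff {q ν : ℝ} (hq : 0 < q) {g : ℂ → ℂ} :
    bergmanNorm q ν g < ∞ ↔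
      ∫⁻ z in upperHalfPlaneSet, ENNReal.ofReal (‖g z‖ ^ q * z.im ^ ν) < ∞ :=
  ENNReal.rpow_lt_top_iff_of_pos (by positivity)

/-- Functions in a weighted Bergman space belong to the little-o growth space. -/
theorem exists_isCompact_forall_norm_mul_rpow_le {q ν t : ℝ} (hq : 1 ≤ q) (ht : t * q = ν + 2)
    {g : ℂ → ℂ} (hg : g ∈ bergmanSpace q ν) {η : ℝ} (hη : 0 < η) :
    ∃ K ⊆ upperHalfPlaneSet, IsCompact K ∧ ∀ z ∈ upperHalfPlaneSet, z ∉ K →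
      ‖g z‖ * z.im ^ t ≤ η := by
  have hq0 : 0 < q := by linarith
  set c : ℝ := 2 ^ (-|ν|) * ((1 / 2) ^ 2 * Real.pi)
  have hc : 0 < c := by positivity
  obtain ⟨K, hKH, hK, hlt⟩ := exists_isCompact_forall_setLIntegral_ball_lt
    ((bergmanNorm_lt_top_iff hq0).1 hg.2)
    (c := ENNReal.ofReal (c * η ^ q)) (ENNReal.ofReal_pos.2 (by positivity)) le_rfl
  refine ⟨K, hKH, hK, fun z hz hzK => ?_⟩
  have hz0 : 0 < z.im := hz
  have hsub : Metric.ball z (1 / 2 * z.im) ⊆ upperHalfPlaneSet := fun w hw =>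
    show 0 < w.im by linarith [(half_im_le_and_im_le_two_mul hz0 le_rfl hw).1]
  have hmean := enorm_rpow_mul_volume_ball_le_lintegral (by positivity) hq (hg.1.mono hsub)
  have hlow : ENNReal.ofReal (2 ^ (-|ν|) * z.im ^ ν) *
      ∫⁻ w in Metric.ball z (1 / 2 * z.im), ‖g w‖ₑ ^ q ≤
      ∫⁻ w in Metric.ball z (1 / 2 * z.im), ENNReal.ofReal (‖g w‖ ^ q * w.im ^ ν) := by
    rw [← lintegral_const_mul' _ _ ENNReal.ofReal_ne_top]
    refine setLIntegral_mono' Metric.isOpen_ball.measurableSet fun w hw => ?_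
    obtain ⟨h1, h2⟩ := half_im_le_and_im_le_two_mul hz0 le_rfl hw
    rw [← ofReal_norm, ENNReal.ofReal_rpow_of_nonneg (norm_nonneg _) hq0.le,
      ← ENNReal.ofReal_mul (by positivity), mul_comm]
    exact ENNReal.ofReal_le_ofReal (mul_le_mul_of_nonneg_left
      (two_rpow_neg_abs_mul_rpow_le hz0 h1 h2 ν) (by positivity))
  have hmain := ((mul_le_mul_right hmean _).trans hlow).trans_lt (hlt z hz hzK)
  rw [← ofReal_norm, ENNReal.ofReal_rpow_of_nonneg (norm_nonneg _) hq0.le,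
    Complex.volume_ball_eq_ofReal _ (by positivity), ← ENNReal.ofReal_mul (by positivity),
    ← ENNReal.ofReal_mul (by positivity), ENNReal.ofReal_lt_ofReal_iff (by positivity)] at hmain
  -- The weight `(Im z)^ν` times the area factor `(Im z)^2` is exactly `((Im z)^t)^q`.
  have hid : 2 ^ (-|ν|) * z.im ^ ν * (‖g z‖ ^ q * ((1 / 2 * z.im) ^ 2 * Real.pi)) =
      c * (‖g z‖ * z.im ^ t) ^ q := by
    rw [Real.mul_rpow (norm_nonneg _) (by positivity), ← Real.rpow_mul hz0.le, ht,
      Real.rpow_add hz0, Real.rpow_two]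
    ring
  rw [hid, mul_lt_mul_iff_right₀ hc, Real.rpow_lt_rpow_iff (by positivity) hη.le hq0] at hmain
  exact hmain.le

/-! ### Convergent superlevel integrals force relative compactness -/

/-- Superlevel sets contain Whitney balls around the points of higher superlevel sets. -/
theorem exists_ball_subset_superlevelSet {t A ε ε' : ℝ} (ht : 0 ≤ t) {f : ℂ → ℂ}
    (hf : DifferentiableOn ℂ f upperHalfPlaneSet)
    (hA : ∀ z ∈ upperHalfPlaneSet, ‖f z‖ * z.im ^ t ≤ A) (hε : ε < ε') :
    ∃ δ, 0 < δ ∧ δ ≤ 1 / 2 ∧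
      ∀ z ∈ superlevelSet ε' t f, Metric.ball z (δ * z.im) ⊆ superlevelSet ε t f := by
  have hA0 : 0 ≤ A := (mul_nonneg (norm_nonneg _) (by simp)).trans
    (hA Complex.I (show 0 < Complex.I.im by simp))
  set B : ℝ := A * 2 ^ t
  have hB : 0 ≤ B := by positivity
  -- This expression is the lower bound for `|f| (Im w)^t` on the ball of radius `δ Im z`: the first
  -- factor comes from the Schwarz lemma, the second from the drop in height.
  have hlim : Filter.Tendsto (fun δ : ℝ => (ε' - 4 * B * δ) * (1 - δ) ^ t)
      (nhdsWithin 0 (Set.Ioi 0)) (nhds ε') := by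
    have : ContinuousAt (fun δ : ℝ => (ε' - 4 * B * δ) * (1 - δ) ^ t) 0 := by
      refine ContinuousAt.mul (by fun_prop) (ContinuousAt.rpow_const (by fun_prop) ?_)
      simp
    simpa using this.tendsto.mono_left nhdsWithin_le_nhds
  obtain ⟨δ, hδε, hδ0, hδ⟩ := ((hlim.eventually_const_lt hε).and
    (Ioc_mem_nhdsGT (show (0 : ℝ) < 1 / 2 by norm_num))).exists
  refine ⟨δ, hδ0, hδ, fun z hz w hw => ?_⟩
  have hz0 : 0 < z.im := hz.1
  have hzt : 0 < z.im ^ t := by positivity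
  have hpt : ∀ w ∈ Metric.ball z (1 / 2 * z.im), w ∈ upperHalfPlaneSet ∧ ‖f w‖ ≤ B / z.im ^ t := by
    intro w hw
    obtain ⟨h1, h2⟩ := half_im_le_and_im_le_two_mul hz0 le_rfl hw
    have hw0 : w ∈ upperHalfPlaneSet := show 0 < w.im by linarith
    refine ⟨hw0, ?_⟩
    have h3 := two_rpow_neg_abs_mul_rpow_le hz0 h1 h2 t
    rw [abs_of_nonneg ht, Real.rpow_neg zero_le_two] at h3
    have h4 := (mul_le_mul_of_nonneg_left h3 (norm_nonneg (f w))).trans (hA w hw0)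
    rw [le_div_iff₀ hzt]
    calc ‖f w‖ * z.im ^ t = ‖f w‖ * ((2 ^ t)⁻¹ * z.im ^ t) * 2 ^ t := by field_simp
      _ ≤ A * 2 ^ t := mul_le_mul_of_nonneg_right h4 (by positivity)
  have hw' : w ∈ Metric.ball z (1 / 2 * z.im) :=
    Metric.ball_subset_ball (mul_le_mul_of_nonneg_right hδ hz0.le) hw
  have hschwarz := Complex.dist_le_div_mul_dist_of_mapsTo_ball (R₂ := 2 * (B / z.im ^ t))
    (hf.mono fun w hw => (hpt w hw).1) (fun w hw => by
      rw [Metric.mem_closedBall, dist_eq_norm]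
      have h1 := (hpt w hw).2
      have h2 := (hpt z (Metric.mem_ball_self (by positivity))).2
      linarith [norm_sub_le (f w) (f z)]) hw'
  have hdist : dist (f w) (f z) ≤ 4 * B * δ / z.im ^ t := by
    refine hschwarz.trans ?_
    have h1 : dist w z ≤ δ * z.im := hw.le
    calc _ ≤ 2 * (B / z.im ^ t) / (1 / 2 * z.im) * (δ * z.im) := by gcongr
      _ = _ := by field_simp; ring
  refine ⟨(hpt w hw').1, hδε.le.trans ?_⟩
  have h1 : ‖f z‖ - 4 * B * δ / z.im ^ t ≤ ‖f w‖ := by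
    rw [dist_eq_norm, norm_sub_rev] at hdist
    linarith [norm_sub_norm_le (f z) (f w)]
  have h2 : (1 - δ) * z.im ≤ w.im := by
    linarith [(abs_lt.1 (abs_im_sub_im_lt hw)).1]
  have h1δ : 0 ≤ 1 - δ := by linarith
  calc (ε' - 4 * B * δ) * (1 - δ) ^ t
      ≤ (‖f z‖ * z.im ^ t - 4 * B * δ) * (1 - δ) ^ t := by
        gcongr
        exact hz.2
    _ = (‖f z‖ - 4 * B * δ / z.im ^ t) * ((1 - δ) * z.im) ^ t := by
        rw [Real.mul_rpow h1δ hz0.le]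
        field_simp
    _ ≤ ‖f w‖ * w.im ^ t := by gcongr

theorem norm_conj_sub_le {z w ζ : ℂ} {r : ℝ} (hw : w ∈ Metric.ball z r)
    (hζ : ζ ∈ Metric.ball z r) : ‖conj w - ζ‖ ≤ 2 * r + 2 * |z.im| := by
  have h1 : conj w - ζ = conj (w - z) + (conj z - z) - (ζ - z) := by
    rw [map_sub]; ring
  have h2 : ‖conj z - z‖ = 2 * |z.im| := by
    rw [norm_sub_rev, Complex.sub_conj]
    simp
  rw [Metric.mem_ball, dist_eq_norm] at hw hζ
  rw [h1]
  refine (norm_sub_le _ _).trans ?_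
  have h3 := norm_add_le (conj (w - z)) (conj z - z)
  rw [h2, Complex.norm_conj] at h3
  linarith

theorem im_add_im_le_norm_conj_sub (w z : ℂ) : w.im + z.im ≤ ‖conj w - z‖ := by
  have h := (neg_le_abs _).trans (Complex.abs_im_le_norm (conj w - z))
  simp only [Complex.sub_im, Complex.conj_im] at h
  linarith

/-- If the superlevel integral at height `ε` converges, all higher superlevel sets are relatively
compact in the half-plane. -/
theorem exists_isCompact_superlevelSet_subset {q ν t β A ε ε' : ℝ} (hq : 0 < q)
    (ht : 0 ≤ t) (htq : t * q = ν + 2) (hβ : 0 ≤ β + 2) {f : ℂ → ℂ}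
    (hf : DifferentiableOn ℂ f upperHalfPlaneSet)
    (hA : ∀ z ∈ upperHalfPlaneSet, ‖f z‖ * z.im ^ t ≤ A) (hε : ε < ε')
    (hI : superlevelIntegral q ν t β ε f < ∞) :
    ∃ K ⊆ upperHalfPlaneSet, IsCompact K ∧ superlevelSet ε' t f ⊆ K := by
  obtain ⟨δ, hδ0, hδ, hball⟩ := exists_ball_subset_superlevelSet ht hf hA hε
  -- With `y = Im z`, the inner integral over the ball is at least a constant times `y^(β-t)
  -- y^(-β-2) y^2 = y^(-t)`. The outer one is then at least a constant times `y^(-tq) y^ν y^2 = 1`.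
  -- The 4 comes from `|w̄ - ζ| ≤ 4y`.
  set c₁ : ℝ := 2 ^ (-|β - t|) / 4 ^ (β + 2) * (δ ^ 2 * Real.pi)
  set c₂ : ℝ := c₁ ^ q * 2 ^ (-|ν|) * (δ ^ 2 * Real.pi)
  have hc₁ : 0 < c₁ := by positivity
  have hc₂ : 0 < c₂ := by positivity
  obtain ⟨K, hKH, hK, hlt⟩ := exists_isCompact_forall_setLIntegral_ball_lt hI
    (ENNReal.ofReal_pos.2 hc₂) hδ
  refine ⟨K, hKH, hK, fun z hz => by_contra fun hzK => (hlt z hz.1 hzK).not_ge ?_⟩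
  have hz0 : 0 < z.im := hz.1
  have hδz : δ * z.im ≤ 1 / 2 * z.im := mul_le_mul_of_nonneg_right hδ hz0.le
  have hvol := Complex.volume_ball_eq_ofReal z (r := δ * z.im) (by positivity)
  have hinner : ∀ ζ ∈ Metric.ball z (δ * z.im), ENNReal.ofReal (c₁ * z.im ^ (-t)) ≤
      ∫⁻ w in superlevelSet ε t f,
        ENNReal.ofReal (w.im ^ (β - t) / ‖conj w - ζ‖ ^ (β + 2)) := by
    intro ζ hζ
    calc ENNReal.ofReal (c₁ * z.im ^ (-t))
        = ∫⁻ _ in Metric.ball z (δ * z.im),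
            ENNReal.ofReal (2 ^ (-|β - t|) * z.im ^ (β - t) / (4 * z.im) ^ (β + 2)) := by
          rw [setLIntegral_const, hvol, ← ENNReal.ofReal_mul (by positivity)]
          congr 1
          rw [Real.mul_rpow (by norm_num) hz0.le, show β - t = (β + 2) + (-t) + (-2) by ring,
            Real.rpow_add hz0, Real.rpow_add hz0, Real.rpow_neg hz0.le 2, Real.rpow_two]
          have : z.im ^ (β + 2) ≠ 0 := by positivity
          simp only [c₁]
          rw [show β - t = (β + 2) + (-t) + (-2) by ring]
          field_simp
      _ ≤ ∫⁻ w in Metric.ball z (δ * z.im),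
            ENNReal.ofReal (w.im ^ (β - t) / ‖conj w - ζ‖ ^ (β + 2)) := by
          refine setLIntegral_mono' Metric.isOpen_ball.measurableSet fun w hw => ?_
          obtain ⟨h1, h2⟩ := half_im_le_and_im_le_two_mul hz0 hδ hw
          obtain ⟨h3, -⟩ := half_im_le_and_im_le_two_mul hz0 hδ hζ
          have h4 : 0 < ‖conj w - ζ‖ :=
            lt_of_lt_of_le (by linarith) (im_add_im_le_norm_conj_sub w ζ)
          have h5 : ‖conj w - ζ‖ ≤ 4 * z.im := by
            have := norm_conj_sub_le hw hζ
            rw [abs_of_pos hz0] at this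
            linarith
          have h6 : 0 < w.im := by linarith
          refine ENNReal.ofReal_le_ofReal ?_
          gcongr
          exact two_rpow_neg_abs_mul_rpow_le hz0 h1 h2 _
      _ ≤ _ := lintegral_mono_set (hball z hz)
  calc ENNReal.ofReal c₂
      = ∫⁻ _ in Metric.ball z (δ * z.im),
          ENNReal.ofReal (c₁ * z.im ^ (-t)) ^ q * ENNReal.ofReal (2 ^ (-|ν|) * z.im ^ ν) := by
        rw [setLIntegral_const, hvol, ENNReal.ofReal_rpow_of_nonneg (by positivity) hq.le,
          ← ENNReal.ofReal_mul (by positivity), ← ENNReal.ofReal_mul (by positivity)]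
        congr 1
        rw [Real.mul_rpow hc₁.le (by positivity), ← Real.rpow_mul hz0.le,
          show -t * q = -ν + (-2) by linarith, Real.rpow_add hz0, Real.rpow_neg hz0.le,
          Real.rpow_neg hz0.le, Real.rpow_two]
        have : z.im ^ ν ≠ 0 := by positivity
        simp only [c₂]
        field_simp
    _ ≤ _ := by
        refine setLIntegral_mono' Metric.isOpen_ball.measurableSet fun ζ hζ => ?_
        obtain ⟨h1, h2⟩ := half_im_le_and_im_le_two_mul hz0 hδ hζ
        exact mul_le_mul' (ENNReal.rpow_le_rpow (hinner ζ hζ) hq.le)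
          (ENNReal.ofReal_le_ofReal (two_rpow_neg_abs_mul_rpow_le hz0 h1 h2 ν))

/-! ### Convergence for relatively compact superlevel sets -/

/-- As `|w̄ - z| ≥ Im w`, the triangle inequality bounds `|z + i| / |w̄ - z|` by `1 + |w̄ + i| / Im
w`, which is bounded for `w` in a compact set. -/
theorem exists_forall_kernel_le {K : Set ℂ} (hK : IsCompact K) (hKH : K ⊆ upperHalfPlaneSet)
    (s : ℝ) {p : ℝ} (hp : 0 ≤ p) :
    ∃ C, 0 ≤ C ∧ ∀ w ∈ K, ∀ z ∈ upperHalfPlaneSet,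
      w.im ^ s / ‖conj w - z‖ ^ p ≤ C * ‖z + Complex.I‖ ^ (-p) := by
  have hcont : ContinuousOn
      (fun w : ℂ => w.im ^ s * (1 + ‖conj w + Complex.I‖ / w.im) ^ p) K := by
    have him : ContinuousOn Complex.im K := Complex.continuous_im.continuousOn
    have hne : ∀ w ∈ K, w.im ≠ 0 := fun w hw => (show 0 < w.im from hKH hw).ne'
    refine (him.rpow_const fun w hw => Or.inl (hne w hw)).mul
      (ContinuousOn.rpow_const ?_ fun w hw => Or.inr hp)
    exact continuousOn_const.add (ContinuousOn.div (by fun_prop) him hne)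
  obtain ⟨C, hC⟩ := hK.exists_bound_of_continuousOn hcont
  refine ⟨max C 0, le_max_right _ _, fun w hw z hz => ?_⟩
  have hw0 : 0 < w.im := hKH hw
  have hz0 : 0 < z.im := hz
  have h1 : w.im ≤ ‖conj w - z‖ := by linarith [im_add_im_le_norm_conj_sub w z]
  have h2 : 0 < ‖conj w - z‖ := by linarith
  have h3 : 0 < ‖z + Complex.I‖ := by linarith [one_add_im_le_norm_add_I z]
  have h4 : ‖z + Complex.I‖ ≤ ‖conj w - z‖ * (1 + ‖conj w + Complex.I‖ / w.im) := by
    have h5 : ‖z + Complex.I‖ ≤ ‖conj w - z‖ + ‖conj w + Complex.I‖ := by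
      have h6 := norm_sub_le (conj w + Complex.I) (conj w - z)
      rw [show (conj w + Complex.I) - (conj w - z) = z + Complex.I by ring] at h6
      linarith
    have h6 : ‖conj w + Complex.I‖ ≤ ‖conj w - z‖ * (‖conj w + Complex.I‖ / w.im) := by
      rw [mul_div_assoc', le_div_iff₀ hw0, mul_comm]
      exact mul_le_mul_of_nonneg_right h1 (norm_nonneg _)
    linarith
  have h7 := Real.rpow_le_rpow h3.le h4 hp
  rw [Real.mul_rpow h2.le (by positivity)] at h7
  have h8 := (le_abs_self _).trans (hC w hw)
  rw [Real.rpow_neg h3.le, div_le_iff₀ (by positivity), mul_right_comm, ← div_eq_mul_inv,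
    le_div_iff₀ (by positivity)]
  calc w.im ^ s * ‖z + Complex.I‖ ^ p
      ≤ w.im ^ s * (‖conj w - z‖ ^ p * (1 + ‖conj w + Complex.I‖ / w.im) ^ p) := by gcongr
    _ = (w.im ^ s * (1 + ‖conj w + Complex.I‖ / w.im) ^ p) * ‖conj w - z‖ ^ p := by ring
    _ ≤ max C 0 * ‖conj w - z‖ ^ p := by
        gcongr
        exact h8.trans (le_max_left _ _)

theorem superlevelIntegral_lt_top_of_subset {q ν t β ε : ℝ} (hq : 0 < q) (hν : -1 < ν)
    (hβ : 0 ≤ β + 2) (hβq : ν + 2 < (β + 2) * q) {f : ℂ → ℂ} {K : Set ℂ} (hK : IsCompact K)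
    (hKH : K ⊆ upperHalfPlaneSet) (hVK : superlevelSet ε t f ⊆ K) :
    superlevelIntegral q ν t β ε f < ∞ := by
  obtain ⟨C, hC0, hC⟩ := exists_forall_kernel_le hK hKH (β - t) hβ
  have hfin : (ENNReal.ofReal C * volume K) ^ q < ∞ :=
    ENNReal.rpow_lt_top_of_nonneg hq.le
      (ENNReal.mul_lt_top ENNReal.ofReal_lt_top hK.measure_lt_top).ne
  refine lt_of_le_of_lt ?_
    (ENNReal.mul_lt_top hfin (lintegral_norm_add_I_rpow_lt_top hν hβq))
  rw [← lintegral_const_mul' _ _ hfin.ne]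
  refine setLIntegral_mono' isOpen_upperHalfPlaneSet.measurableSet fun z hz => ?_
  have hz0 : 0 < z.im := hz
  have hinner : ∫⁻ w in superlevelSet ε t f,
      ENNReal.ofReal (w.im ^ (β - t) / ‖conj w - z‖ ^ (β + 2)) ≤
      ENNReal.ofReal C * volume K * ENNReal.ofReal (‖z + Complex.I‖ ^ (-(β + 2))) := by
    refine (lintegral_mono_set hVK).trans ?_
    refine (setLIntegral_mono' hK.isClosed.measurableSet fun w hw =>
      ENNReal.ofReal_le_ofReal (hC w hw z hz)).trans ?_
    rw [setLIntegral_const, ENNReal.ofReal_mul hC0, mul_right_comm]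
  refine (mul_le_mul_left (ENNReal.rpow_le_rpow hinner hq.le) _).trans (le_of_eq ?_)
  rw [ENNReal.mul_rpow_of_nonneg _ _ hq.le, ENNReal.ofReal_rpow_of_nonneg (by positivity) hq.le,
    mul_assoc, ← ENNReal.ofReal_mul (by positivity), ← Real.rpow_mul (norm_nonneg _), neg_mul]

/-! ### Approximation by decaying functions -/

/-- Holomorphic functions on the half-plane that are `O(|z + i|^{-M})`. -/
def decaySubmodule (M : ℕ) : Submodule ℂ (ℂ → ℂ) where
  carrier := {v | DifferentiableOn ℂ v upperHalfPlaneSet ∧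
    ∃ C : ℝ, ∀ z ∈ upperHalfPlaneSet, ‖v z‖ ≤ C * ‖z + Complex.I‖ ^ (-(M : ℝ))}
  zero_mem' := ⟨differentiableOn_const 0, 0, fun z _ => by simp⟩
  add_mem' := by
    rintro v w ⟨hv, C, hC⟩ ⟨hw, D, hD⟩
    refine ⟨hv.add hw, C + D, fun z hz => ?_⟩
    rw [add_mul]
    exact (norm_add_le _ _).trans (add_le_add (hC z hz) (hD z hz))
  smul_mem' := by
    rintro a v ⟨hv, C, hC⟩
    refine ⟨hv.const_smul a, ‖a‖ * C, fun z hz => ?_⟩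
    rw [Pi.smul_apply, norm_smul, mul_assoc]
    exact mul_le_mul_of_nonneg_left (hC z hz) (norm_nonneg a)

theorem decaySubmodule_subset_bergmanSpace {q ν : ℝ} {M : ℕ} (hq : 0 < q) (hν : -1 < ν)
    (hM : ν + 2 < M * q) : (decaySubmodule M : Set (ℂ → ℂ)) ⊆ bergmanSpace q ν := by
  rintro v ⟨hv, C, hC⟩
  refine ⟨hv, (bergmanNorm_lt_top_iff hq).2 ?_⟩
  refine lt_of_le_of_lt ?_ (ENNReal.mul_lt_top (ENNReal.ofReal_lt_top (r := |C| ^ q))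
    (lintegral_norm_add_I_rpow_lt_top hν hM))
  rw [← lintegral_const_mul' _ _ ENNReal.ofReal_ne_top]
  refine setLIntegral_mono' isOpen_upperHalfPlaneSet.measurableSet fun z hz => ?_
  have hz0 : 0 < z.im := hz
  rw [← ENNReal.ofReal_mul (by positivity)]
  refine ENNReal.ofReal_le_ofReal ?_
  have h1 : ‖v z‖ ≤ |C| * ‖z + Complex.I‖ ^ (-(M : ℝ)) :=
    (hC z hz).trans (mul_le_mul_of_nonneg_right (le_abs_self C) (by positivity))
  have h2 := Real.rpow_le_rpow (norm_nonneg _) h1 hq.le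
  rw [Real.mul_rpow (abs_nonneg C) (by positivity), ← Real.rpow_mul (norm_nonneg _),
    neg_mul] at h2
  rw [← mul_assoc]
  exact mul_le_mul_of_nonneg_right h2 (by positivity)

theorem one_le_norm_real_mul_add_I {s : ℝ} (hs : 0 ≤ s) {z : ℂ} (hz : 0 ≤ z.im) :
    1 ≤ ‖(s : ℂ) * z + Complex.I‖ := by
  have h := (le_abs_self _).trans (Complex.abs_im_le_norm ((s : ℂ) * z + Complex.I))
  simp only [Complex.add_im, Complex.im_ofReal_mul, Complex.I_im] at h
  nlinarith [mul_nonneg hs hz]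

theorem mul_norm_add_I_le_norm_real_mul_add_I {s : ℝ} (hs : 0 ≤ s) (hs1 : s ≤ 1) {z : ℂ}
    (hz : 0 ≤ z.im) : s * ‖z + Complex.I‖ ≤ ‖(s : ℂ) * z + Complex.I‖ := by
  refine le_of_sq_le_sq ?_ (norm_nonneg _)
  rw [mul_pow, Complex.sq_norm, Complex.sq_norm, Complex.normSq_apply, Complex.normSq_apply]
  simp only [Complex.add_im, Complex.add_re, Complex.re_ofReal_mul, Complex.im_ofReal_mul,
    Complex.I_im, Complex.I_re]
  have h1 : s * (z.im + 1) ≤ s * z.im + 1 := by linarith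
  have h2 : 0 ≤ s * (z.im + 1) := by positivity
  nlinarith [mul_self_le_mul_self h2 h1]

/-- Functions in the growth space are limits, uniformly on compact sets, of decaying holomorphic
functions of no larger growth norm. -/
theorem exists_mem_decaySubmodule_approx {t A : ℝ} (ht : 0 ≤ t) (M : ℕ) {f : ℂ → ℂ}
    (hf : DifferentiableOn ℂ f upperHalfPlaneSet)
    (hA : ∀ z ∈ upperHalfPlaneSet, ‖f z‖ * z.im ^ t ≤ A) {K : Set ℂ} (hK : IsCompact K)
    (hKH : K ⊆ upperHalfPlaneSet) {η : ℝ} (hη : 0 < η) :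
    ∃ v ∈ decaySubmodule M, (∀ z ∈ upperHalfPlaneSet, ‖v z‖ * z.im ^ t ≤ A) ∧
      ∀ z ∈ K, ‖f z - v z‖ * z.im ^ t ≤ η := by
  have hA0 : 0 ≤ A := (mul_nonneg (norm_nonneg _) (by simp)).trans
    (hA Complex.I (show 0 < Complex.I.im by simp))
  -- The upward shift makes `f` bounded without raising its growth norm; the second factor has
  -- modulus at most 1 and supplies the decay. At `s = 0` this is `f`.
  set F : ℝ → ℂ → ℂ := fun s z =>
    f (z + s * Complex.I) * (Complex.I / (s * z + Complex.I)) ^ M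
  have hshift : ∀ s : ℝ, 0 ≤ s → ∀ z ∈ upperHalfPlaneSet,
      z + s * Complex.I ∈ upperHalfPlaneSet := by
    intro s hs z hz
    have hz0 : 0 < z.im := hz
    change 0 < (z + s * Complex.I).im
    simp only [Complex.add_im, Complex.im_ofReal_mul, Complex.I_im]
    linarith
  have hne : ∀ s : ℝ, 0 ≤ s → ∀ z ∈ upperHalfPlaneSet, (s : ℂ) * z + Complex.I ≠ 0 :=
    fun s hs z hz => norm_pos_iff.1
      (zero_lt_one.trans_le (one_le_norm_real_mul_add_I hs (le_of_lt hz)))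
  have hcont : ContinuousOn (Function.uncurry F) (Set.Icc 0 1 ×ˢ K) := by
    refine ContinuousOn.mul (hf.continuousOn.comp (by fun_prop) fun p hp =>
      hshift p.1 hp.1.1 p.2 (hKH hp.2)) (ContinuousOn.pow (ContinuousOn.div continuousOn_const
        (by fun_prop) fun p hp => hne p.1 hp.1.1 p.2 (hKH hp.2)) M)
  -- Joint continuity on the compact set `[0,1] × K` gives uniform convergence as `s → 0`.
  have hunif : TendstoUniformlyOn F (F 0) (nhdsWithin 0 (Set.Icc 0 1)) K :=
    UniformContinuousOn.tendstoUniformlyOn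
      ((isCompact_Icc.prod hK).uniformContinuousOn_of_continuous hcont)
      (Set.left_mem_Icc.2 zero_le_one)
  obtain ⟨B, hB⟩ := hK.exists_bound_of_continuousOn (f := fun z : ℂ => z.im ^ t)
    (ContinuousOn.rpow_const (by fun_prop) fun z hz => Or.inr ht)
  have hη' : 0 < η / (|B| + 1) := by positivity
  have hev := Metric.tendstoUniformlyOn_iff.1 hunif _ hη'
  rw [nhdsWithin_Icc_eq_nhdsGE zero_lt_one] at hev
  obtain ⟨s, hs, hs0, hs1⟩ := ((hev.filter_mono (nhdsWithin_mono _ Set.Ioi_subset_Ici_self)).and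
    (Ioc_mem_nhdsGT (zero_lt_one (α := ℝ)))).exists
  have hbound : ∀ z ∈ upperHalfPlaneSet, ‖f (z + s * Complex.I)‖ * (z.im + s) ^ t ≤ A := by
    intro z hz
    simpa using hA _ (hshift s hs0.le z hz)
  have hnorm : ∀ z : ℂ, ‖F s z‖ =
      ‖f (z + s * Complex.I)‖ * (1 / ‖(s : ℂ) * z + Complex.I‖) ^ M := by
    intro z
    simp [F]
  refine ⟨F s, ⟨?_, A * s ^ (-t) * (1 / s) ^ M, fun z hz => ?_⟩, fun z hz => ?_, fun z hz => ?_⟩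
  · refine DifferentiableOn.mul (hf.comp (by fun_prop) (hshift s hs0.le))
      (DifferentiableOn.pow (DifferentiableOn.div (by fun_prop) (by fun_prop)
        (hne s hs0.le)) M)
  · have hz0 : 0 < z.im := hz
    have h1 : ‖f (z + s * Complex.I)‖ ≤ A * s ^ (-t) := by
      rw [Real.rpow_neg hs0.le, ← div_eq_mul_inv, le_div_iff₀ (by positivity)]
      refine le_trans ?_ (hbound z hz)
      gcongr
      linarith
    have h2 : 0 < ‖z + Complex.I‖ := by linarith [one_add_im_le_norm_add_I z]
    have h3 := mul_norm_add_I_le_norm_real_mul_add_I hs0.le hs1 hz0.le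
    rw [hnorm, mul_assoc, Real.rpow_neg h2.le, Real.rpow_natCast, ← inv_pow, ← mul_pow,
      one_div_mul_eq_div, inv_div_left, ← one_div]
    gcongr
  · have hz0 : 0 < z.im := hz
    have h1 := one_le_norm_real_mul_add_I hs0.le hz0.le
    have h2 : (1 / ‖(s : ℂ) * z + Complex.I‖) ^ M ≤ 1 :=
      pow_le_one₀ (by positivity) ((div_le_one (by positivity)).2 h1)
    rw [hnorm]
    refine le_trans ?_ (hbound z hz)
    refine mul_le_mul (mul_le_of_le_one_right (norm_nonneg _) h2) ?_ (by positivity)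
      (norm_nonneg _)
    exact Real.rpow_le_rpow hz0.le (by linarith) ht
  · have h1 := hs z hz
    rw [dist_eq_norm] at h1
    have h2 : F 0 z = f z := by simp [F]
    rw [h2] at h1
    have h3 : z.im ^ t ≤ |B| + 1 := by
      linarith [(le_abs_self _).trans (hB z hz), le_abs_self B]
    calc ‖f z - F s z‖ * z.im ^ t ≤ η / (|B| + 1) * (|B| + 1) :=
          mul_le_mul h1.le h3 (Real.rpow_nonneg (le_of_lt (hKH hz)) _) hη'.le
      _ = η := by field_simp

/-! ### Averaging approximants with separated transition regions -/

/-- Successive approximation along separated scales: the errors of the approximants add up to no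
more than the boundary size of `f`, apart from one transition region. -/
theorem exists_mem_decaySubmodule_sum {q ν t A l δ : ℝ} {M : ℕ} (hq : 1 ≤ q) (hν : -1 < ν)
    (ht : 0 ≤ t) (htq : t * q = ν + 2) (hM : ν + 2 < M * q) {f : ℂ → ℂ}
    (hf : DifferentiableOn ℂ f upperHalfPlaneSet)
    (hA : ∀ z ∈ upperHalfPlaneSet, ‖f z‖ * z.im ^ t ≤ A) (hl : 0 ≤ l) (hδ : 0 < δ)
    {K₀ : Set ℂ} (hK₀ : IsCompact K₀) (hK₀H : K₀ ⊆ upperHalfPlaneSet)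
    (hl₀ : ∀ z ∈ upperHalfPlaneSet, z ∉ K₀ → ‖f z‖ * z.im ^ t ≤ l) (N : ℕ) :
    ∃ S ∈ decaySubmodule M, ∃ K ⊆ upperHalfPlaneSet, IsCompact K ∧ K₀ ⊆ K ∧
      (∀ z ∈ upperHalfPlaneSet, ‖N * f z - S z‖ * z.im ^ t ≤ N * (l + δ) + 2 * A) ∧
      ∀ z ∈ upperHalfPlaneSet, z ∉ K → ‖N * f z - S z‖ * z.im ^ t ≤ N * (l + δ) := by
  have hA0 : 0 ≤ A := (mul_nonneg (norm_nonneg _) (by simp)).trans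
    (hA Complex.I (show 0 < Complex.I.im by simp))
  induction N with
  | zero =>
    refine ⟨0, zero_mem _, K₀, hK₀H, hK₀, subset_rfl, fun z _ => ?_, fun z _ _ => ?_⟩
    · simpa using hA0
    · simp
  | succ N ih =>
    obtain ⟨S, hS, K, hKH, hK, hK₀K, hall, hout⟩ := ih
    obtain ⟨v, hv, hvA, hvK⟩ := exists_mem_decaySubmodule_approx ht M hf hA hK hKH hδ
    obtain ⟨K', hK'H, hK', hvK'⟩ := exists_isCompact_forall_norm_mul_rpow_le hq htq
      (decaySubmodule_subset_bergmanSpace (by linarith) hν hM hv) hδ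
    have hsplit : ∀ z ∈ upperHalfPlaneSet, ‖((N + 1 : ℕ) : ℂ) * f z - (S + v) z‖ * z.im ^ t ≤
        ‖N * f z - S z‖ * z.im ^ t + ‖f z - v z‖ * z.im ^ t := by
      intro z hz
      rw [← add_mul]
      refine mul_le_mul_of_nonneg_right ?_ (Real.rpow_nonneg (le_of_lt hz) _)
      refine le_trans (le_of_eq ?_) (norm_add_le _ _)
      rw [Pi.add_apply]
      push_cast
      ring_nf
    have hfv : ∀ z ∈ upperHalfPlaneSet, ‖f z - v z‖ * z.im ^ t ≤
        ‖f z‖ * z.im ^ t + ‖v z‖ * z.im ^ t := by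
      intro z hz
      rw [← add_mul]
      exact mul_le_mul_of_nonneg_right (norm_sub_le _ _) (Real.rpow_nonneg (le_of_lt hz) _)
    refine ⟨S + v, add_mem hS hv, K ∪ K', Set.union_subset hKH hK'H, hK.union hK',
      hK₀K.trans Set.subset_union_left, fun z hz => ?_, fun z hz hzK => ?_⟩
    · refine (hsplit z hz).trans ?_
      push_cast
      -- On `K` the new error is at most `δ`. Off `K` the earlier errors carry no excess, so the
      -- full new error `2A` is affordable.
      by_cases hzK : z ∈ K
      · linarith [hall z hz, hvK z hzK]
      · linarith [hout z hz hzK, hfv z hz, hA z hz, hvA z hz]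
    · rw [Set.mem_union, not_or] at hzK
      refine (hsplit z hz).trans ?_
      push_cast
      linarith [hout z hz hzK.1, hfv z hz, hl₀ z hz (fun h => hzK.1 (hK₀K h)),
        hvK' z hz hzK.2]

/-- The distance to the Bergman space is at most the boundary size of the function. -/
theorem growthDist_bergmanSpace_le {q ν t A l ε : ℝ} (hq : 1 ≤ q) (hν : -1 < ν)
    (htq : t * q = ν + 2) {f : ℂ → ℂ} (hf : DifferentiableOn ℂ f upperHalfPlaneSet)
    (hA : ∀ z ∈ upperHalfPlaneSet, ‖f z‖ * z.im ^ t ≤ A) (hl : 0 ≤ l) (hε : l < ε)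
    {K : Set ℂ} (hK : IsCompact K) (hKH : K ⊆ upperHalfPlaneSet)
    (hlK : ∀ z ∈ upperHalfPlaneSet, z ∉ K → ‖f z‖ * z.im ^ t ≤ l) :
    growthDist t f (bergmanSpace q ν) ≤ ENNReal.ofReal ε := by
  have hq0 : 0 < q := by linarith
  have ht : 0 ≤ t := by
    by_contra! h
    nlinarith
  obtain ⟨M, hM⟩ := exists_nat_gt t
  have hM' : ν + 2 < M * q := htq ▸ mul_lt_mul_of_pos_right hM hq0
  have hδ : 0 < (ε - l) / 2 := by linarith
  -- With `δ = (ε - l)/2`, this makes the averaged error `l + δ + 2A/N` at most `ε`.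
  obtain ⟨N, hN⟩ := exists_nat_gt (max 0 (2 * A / ((ε - l) / 2)))
  have hN0 : (0 : ℝ) < N := (le_max_left _ _).trans_lt hN
  have hNA : 2 * A ≤ N * ((ε - l) / 2) := by
    rw [← div_le_iff₀ hδ]
    exact ((le_max_right _ _).trans_lt hN).le
  obtain ⟨S, hS, -, -, -, -, hall, -⟩ := exists_mem_decaySubmodule_sum hq hν ht htq hM' hf hA hl
    hδ hK hKH hlK N
  have hNc : (N : ℂ) ≠ 0 := by exact_mod_cast hN0.ne'
  refine (iInf₂_le ((N : ℂ)⁻¹ • S)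
    (decaySubmodule_subset_bergmanSpace hq0 hν hM' (Submodule.smul_mem _ _ hS))).trans ?_
  refine (growthNorm_le_ofReal_iff (by linarith)).2 fun z hz => ?_
  have h1 : (f - (N : ℂ)⁻¹ • S) z = (N : ℂ)⁻¹ * (N * f z - S z) := by
    rw [Pi.sub_apply, Pi.smul_apply, smul_eq_mul]
    field_simp
  rw [h1, norm_mul, norm_inv, Complex.norm_natCast, mul_assoc, inv_mul_le_iff₀ hN0]
  linarith [hall z hz]

/-! ### The distance formula -/

theorem theorem2p5 (q ν t β : ℝ) (hq : 1 < q) (hν : -1 < ν) (ht : t = (ν + 2) / q)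
    (hβ : max (ν / q) ((ν + 2) / q - 1) < β) (f : ℂ → ℂ) (hf : f ∈ growthSpace t) :
    growthDist t f (bergmanSpace q ν) =
      sInf {a : ℝ≥0∞ | ∃ ε : ℝ, 0 < ε ∧ superlevelIntegral q ν t β ε f < ∞ ∧
        a = ENNReal.ofReal ε} := by
  have hq0 : 0 < q := by linarith
  have htq : t * q = ν + 2 := by rw [ht, div_mul_cancel₀ _ hq0.ne']
  have ht0 : 0 < t := ht ▸ div_pos (by linarith) hq0
  have hβt : t - 1 < β := ht ▸ (le_max_right _ _).trans_lt hβ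
  have hβ2 : 0 ≤ β + 2 := by linarith
  -- From `β > t - 1` follows `β + 2 > t`; multiplying by `q` gives the convergence condition at
  -- infinity.
  have hβq : ν + 2 < (β + 2) * q := htq ▸ mul_lt_mul_of_pos_right (by linarith) hq0
  have hA := (growthNorm_le_ofReal_iff ENNReal.toReal_nonneg).1
    (ENNReal.ofReal_toReal hf.2.ne).ge
  refine le_antisymm (le_sInf ?_) (le_iInf₂ fun g hg => ?_)
  · rintro _ ⟨ε, hε, hI, rfl⟩
    refine le_of_forall_gt_imp_ge_of_dense fun c hc => ?_
    obtain ⟨ε', -, hεε', hc'⟩ := ENNReal.lt_iff_exists_real_btwn.1 hc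
    have hlt : ε < ε' := (ENNReal.ofReal_lt_ofReal_iff_of_nonneg hε.le).1 hεε'
    refine le_trans ?_ hc'.le
    obtain ⟨K, hKH, hK, hsub⟩ := exists_isCompact_superlevelSet_subset hq0 ht0.le htq hβ2 hf.1 hA
      (show ε < (ε + ε') / 2 by linarith) hI
    refine growthDist_bergmanSpace_le hq.le hν htq hf.1 hA (l := (ε + ε') / 2) (by linarith)
      (by linarith) hK hKH fun z hz hzK => ?_
    by_contra! h
    exact hzK (hsub ⟨hz, h.le⟩)
  · refine le_of_forall_gt_imp_ge_of_dense fun c hc => ?_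
    obtain ⟨a, ha, hga, hac⟩ := ENNReal.lt_iff_exists_real_btwn.1 hc
    obtain ⟨ε, -, haε, hεc⟩ := ENNReal.lt_iff_exists_real_btwn.1 hac
    have hlt : a < ε := (ENNReal.ofReal_lt_ofReal_iff_of_nonneg ha).1 haε
    refine le_trans (sInf_le ⟨ε, by linarith, ?_, rfl⟩) hεc.le
    -- Off `K` one has `|f| (Im z)^t ≤ a + (ε - a)/2 < ε`, so the `ε`-superlevel set lies in `K`.
    obtain ⟨K, hKH, hK, hgK⟩ := exists_isCompact_forall_norm_mul_rpow_le hq.le htq hg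
      (show 0 < (ε - a) / 2 by linarith)
    refine superlevelIntegral_lt_top_of_subset hq0 hν hβ2 hβq hK hKH fun z hz => ?_
    by_contra hzK
    have h1 := hgK z hz.1 hzK
    have h2 := (growthNorm_le_ofReal_iff ha).1 hga.le z hz.1
    have h3 : ‖f z‖ * z.im ^ t ≤ ‖(f - g) z‖ * z.im ^ t + ‖g z‖ * z.im ^ t := by
      rw [← add_mul]
      refine mul_le_mul_of_nonneg_right ?_ (Real.rpow_nonneg (le_of_lt hz.1) _)
      simpa using norm_add_le ((f - g) z) (g z)
    linarith [hz.2]
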